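/- Let $n\in\mathbb{N}$, $a\in\mathbb{R}^n$, $b\in\mathbb{R}$, $H=\{y\in\mathbb{R}^n : \langle a,y\rangle=b\}$, and fix $\overline{x}\in H$. Let $\xi$ and $\zeta$ be independent random variables with values in $\mathbb{R}^n$ and $\mathbb{R}$, with $a+\xi\neq 0$ almost surely, and let $$T_{(\xi,\zeta)}x = x-\frac{\langle a+\xi,\,x-\overline{x}\rangle-\zeta}{\|a+\xi\|^2}\,(a+\xi)$$ be the orthogonal projection of $x\in\mathbb{R}^n$ onto the random hyperplane $\{x : \langle a+\xi,x-\overline{x}\rangle=\zeta\}$. Assume that $$d:=\mathbb{E}\left[\frac{(b+\zeta)^2}{\|a+\xi\|^2}\right]<\infty,\qquad c:=\inf_{\|z\|=1}\mathbb{E}\left[\frac{\langle a+\xi,z\rangle^2}{\|a+\xi\|^2}\right]>0,$$ and, in the degenerate case that $\zeta=-b$ almost surely, also that $\mathbb{E}[b^2/\|a+\xi\|^2]<\infty$. For a probability measure $\mu$ on $\mathbb{R}^n$ let $\mu\mathcal{P}(A)=\int \mathbb{P}(T_{(\xi,\zeta)}x\in A)\,\mu(dx)$; $\mu$ is invariant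 if $\mu\mathcal{P}=\mu$. Let $W_2(\mu,\nu)=\left(\inf_\gamma\int\|x-y\|^2\,\gamma(dx,dy)\right)^{1/2}\in[0,\infty]$, the infimum being over all couplings $\gamma$ of the probability measures $\mu$ and $\nu$. Then $c\le 1$, and there is exactly one invariant probability measure $\pi$ on $\mathbb{R}^n$; it has finite second moment. Moreover, let $X_{k+1}=T_{(\xi_k,\zeta_k)}X_k$ almost surely ($k\in\mathbb{N}$), where the pairs $(\xi_k,\zeta_k)$ are i.i.d. with the law of $(\xi,\zeta)$ and $X_0$ is any $\mathbb{R}^n$-valued random variable that is independent of the sequence $((\xi_k,\zeta_k))_{k\in\mathbb{N}}$, and let $\mu_k$ be the law of $X_k$. Then $$W_2(\mu_{k+1},\pi)\le\sqrt{1-c}\;W_2(\mu_k,\pi)\qquad\text{for all }k\in\mathbb{N},$$ with $\sqrt{1-c}\in[0,1)$ (if $W_2(\mu_k,\pi)=\infty$ and $c=1$, the right-hand side is read as $0$). If $\mu_0$ has finite second moment, then $W_2(\mu_0,\pi)<\infty$ and $W_2(\mu_k,\pi)\to 0$. For every $X_0$, $\mu_k$ converges to $\pi$ in distribution. -/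

import Mathlib

open MeasureTheory ProbabilityTheory Filter Topology
open scoped ENNReal

universe u v

/-! ### Wasserstein distance -/

/-- `γ` is a coupling of `μ` and `ν`: its marginals are `μ` and `ν`. -/
def IsCoupling {G : Type*} [MeasurableSpace G] (γ : Measure (G × G)) (μ ν : Measure G) : Prop :=
  γ.map Prod.fst = μ ∧ γ.map Prod.snd = ν

/-- The Wasserstein 2-distance, with values in `[0, ∞]`, so that it makes sense for all
probability measures and is finite on those with finite second moment. -/
noncomputable def W2 {G : Type*} [MeasurableSpace G] [PseudoEMetricSpace G]
    (μ ν : Measure G) : ℝ≥0∞ :=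
  (⨅ (γ : Measure (G × G)) (_ : IsCoupling γ μ ν),
    ∫⁻ p, edist p.1 p.2 ^ 2 ∂γ) ^ (1 / 2 : ℝ)

/-- The set `𝒫₂(G)`: probability measures with finite second moment. -/
def MemP2 {G : Type*} [MeasurableSpace G] [PseudoEMetricSpace G] (μ : Measure G) : Prop :=
  IsProbabilityMeasure μ ∧ ∃ x : G, ∫⁻ y, edist x y ^ 2 ∂μ < ∞

/-- Q-linear convergence of `μ k` to `π` with rate `r ∈ [0, 1)` with respect to `W2`. -/
def QLinearW2 {G : Type*} [MeasurableSpace G] [PseudoEMetricSpace G]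
    (μ : ℕ → Measure G) (π : Measure G) (r : ℝ) : Prop :=
  0 ≤ r ∧ r < 1 ∧ ∀ k, W2 (μ (k + 1)) π ≤ ENNReal.ofReal r * W2 (μ k) π

/-! ### Random function iterations -/

/-- The transition kernel `p(x, A) = ρ {i | T i x ∈ A}` of the random function iteration with
maps `T i`, where `i` is distributed according to `ρ`. -/
noncomputable def rfiKernel {G I : Type*} [MeasurableSpace G] [MeasurableSpace I]
    (T : I → G → G) (hT : Measurable fun q : G × I => T q.2 q.1)
    (ρ : Measure I) [SFinite ρ] : Kernel G G where
  toFun x := ρ.map fun i => T i x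
  measurable' := by
    refine Measure.measurable_of_measurable_coe _ fun A hA => ?_
    have h : ∀ x, (ρ.map fun i => T i x) A
        = ρ (Prod.mk x ⁻¹' ((fun q : G × I => T q.2 q.1) ⁻¹' A)) := fun x =>
      Measure.map_apply (hT.comp measurable_prodMk_left) hA
    simp_rw [h]
    exact measurable_measure_prodMk_left (hT hA)

/-- `X` is generated by the random function iteration `X (k + 1) = T (η k) (X k)` on the
probability space `(Ω, Q)`, with i.i.d. indices `η k` of law `ρ` that are independent of `X 0`. -/
structure IsRFI {G I Ω : Type*} [MeasurableSpace G] [MeasurableSpace I] [MeasurableSpace Ω]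
    (T : I → G → G) (ρ : Measure I) (Q : Measure Ω) (η : ℕ → Ω → I) (X : ℕ → Ω → G) : Prop where
  measurable_init : Measurable (X 0)
  measurable_index : ∀ k, Measurable (η k)
  law_index : ∀ k, Q.map (η k) = ρ
  indep_index : iIndepFun η Q
  indep_init : IndepFun (X 0) (fun ω k => η k ω) Q
  step : ∀ k, ∀ᵐ ω ∂Q, X (k + 1) ω = T (η k ω) (X k ω)

/-! ### Randomly perturbed hyperplanes -/

/-- The perturbed hyperplane `{x | ⟨a + ξ, x - x̄⟩ = ζ}`, where `e = (ξ, ζ)`. -/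
def noisyHyperplane {n : ℕ} (a xbar : EuclideanSpace ℝ (Fin n))
    (e : EuclideanSpace ℝ (Fin n) × ℝ) : Set (EuclideanSpace ℝ (Fin n)) :=
  {x | inner ℝ (a + e.1) (x - xbar) = e.2}

/-- The exact projection onto the perturbed hyperplane, by its closed formula
(which presupposes `a + ξ ≠ 0`). -/
noncomputable def noisyProj {n : ℕ} (a xbar : EuclideanSpace ℝ (Fin n))
    (e : EuclideanSpace ℝ (Fin n) × ℝ) (x : EuclideanSpace ℝ (Fin n)) :
    EuclideanSpace ℝ (Fin n) :=
  x - ((inner ℝ (a + e.1) (x - xbar) - e.2) / ‖a + e.1‖ ^ 2) • (a + e.1)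

/-- The formula gives a point of the hyperplane. -/
theorem noisyProj_mem {n : ℕ} (a xbar : EuclideanSpace ℝ (Fin n))
    (e : EuclideanSpace ℝ (Fin n) × ℝ) (x : EuclideanSpace ℝ (Fin n)) (h : a + e.1 ≠ 0) :
    noisyProj a xbar e x ∈ noisyHyperplane a xbar e := by
  have h' : ‖a + e.1‖ ^ 2 ≠ 0 := by simpa using h
  simp only [noisyHyperplane, noisyProj, Set.mem_ofPred_eq]
  rw [sub_right_comm, inner_sub_right, inner_smul_right, real_inner_self_eq_norm_sq,
    div_mul_cancel₀ _ h']
  ring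

/-- The formula gives the unique nearest point of the hyperplane. -/
theorem noisyProj_nearest {n : ℕ} (a xbar : EuclideanSpace ℝ (Fin n))
    (e : EuclideanSpace ℝ (Fin n) × ℝ) (x y : EuclideanSpace ℝ (Fin n)) (h : a + e.1 ≠ 0)
    (hy : y ∈ noisyHyperplane a xbar e) (hne : y ≠ noisyProj a xbar e x) :
    dist x (noisyProj a xbar e x) < dist x y := by
  have hp := noisyProj_mem a xbar e x h
  set p := noisyProj a xbar e x with hpdef
  simp only [noisyHyperplane, Set.mem_ofPred_eq] at hp hy
  have h0 : inner ℝ (x - p) (p - y) = 0 := by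
    have : x - p = ((inner ℝ (a + e.1) (x - xbar) - e.2) / ‖a + e.1‖ ^ 2) • (a + e.1) := by
      rw [hpdef, noisyProj]; abel
    rw [this, inner_smul_left, show p - y = (p - xbar) - (y - xbar) by abel,
      inner_sub_right (a + e.1) (p - xbar) (y - xbar), hp, hy]
    simp
  have h1 : ‖x - y‖ ^ 2 = ‖x - p‖ ^ 2 + ‖p - y‖ ^ 2 := by
    rw [show x - y = (x - p) + (p - y) by abel, norm_add_sq_real, h0]; ring
  have h2 : 0 < ‖p - y‖ := norm_pos_iff.2 (sub_ne_zero.2 hne.symm)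
  rw [dist_eq_norm, dist_eq_norm]
  nlinarith [norm_nonneg (x - y), norm_nonneg (x - p)]

theorem measurable_noisyProj {n : ℕ} (a xbar : EuclideanSpace ℝ (Fin n)) :
    Measurable fun q : EuclideanSpace ℝ (Fin n) × (EuclideanSpace ℝ (Fin n) × ℝ) =>
      noisyProj a xbar q.2 q.1 := by
  unfold noisyProj
  fun_prop

/-- The moment `d = 𝔼[(b + ζ)² / ‖a + ξ‖²]`, as an element of `[0, ∞]`. -/
noncomputable def noiseMoment {n : ℕ} {Ω : Type*} [MeasurableSpace Ω] (P : Measure Ω)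
    (a : EuclideanSpace ℝ (Fin n)) (b : ℝ) (ξ : Ω → EuclideanSpace ℝ (Fin n)) (ζ : Ω → ℝ) :
    ℝ≥0∞ :=
  ∫⁻ ω, ENNReal.ofReal ((b + ζ ω) ^ 2 / ‖a + ξ ω‖ ^ 2) ∂P

/-- The constant `c = inf_{‖z‖ = 1} 𝔼[⟨a + ξ, z⟩² / ‖a + ξ‖²]`; the integrand is bounded by `1`,
and the infimum is over a nonempty set when `n ≥ 1`. -/
noncomputable def noiseIsotropy {n : ℕ} {Ω : Type*} [MeasurableSpace Ω] (P : Measure Ω)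
    (a : EuclideanSpace ℝ (Fin n)) (ξ : Ω → EuclideanSpace ℝ (Fin n)) : ℝ :=
  ⨅ z : Metric.sphere (0 : EuclideanSpace ℝ (Fin n)) 1,
    ∫ ω, (inner ℝ (a + ξ ω) (z : EuclideanSpace ℝ (Fin n))) ^ 2 / ‖a + ξ ω‖ ^ 2 ∂P

/-- The transition kernel of the iteration of projections onto the perturbed hyperplanes, for the
noise `(ξ, ζ)` on the probability space `(Ω, P)`. -/
noncomputable def noisyProjKernel {n : ℕ} {Ω : Type*} [MeasurableSpace Ω] (P : Measure Ω)
    [IsProbabilityMeasure P] (a xbar : EuclideanSpace ℝ (Fin n))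
    (ξ : Ω → EuclideanSpace ℝ (Fin n)) (ζ : Ω → ℝ) :
    Kernel (EuclideanSpace ℝ (Fin n)) (EuclideanSpace ℝ (Fin n)) :=
  rfiKernel (noisyProj a xbar) (measurable_noisyProj a xbar) (P.map fun ω => (ξ ω, ζ ω))

/-! ### Inequalities in `ℝ≥0∞` -/

/-! By Pythagoras, projecting two points onto the same hyperplane reduces their squared distance by
`⟨a + ξ, x - y⟩² / ‖a + ξ‖²` (`norm_noisyProj_sub_sq`). In expectation this is at least `c ‖x -
y‖²`, so the random projection is a mean-square contraction with ratio `r = √(1 - c) < 1`. It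
displaces `x̄` by `|ζ| / ‖a + ξ‖`, which is square integrable
(`lintegral_noise_sq_div_norm_sq_lt_top`).

These two facts suffice on a complete separable metric space, given continuous maps. Driving both
marginals of a coupling by the same index contracts the cost, hence `W2` (`W2_rfiStep_le`).
Composing the maps in reverse order turns convergence in law into almost sure convergence: the
backward iterates are almost surely Cauchy, and the law of their limit is invariant with finite
second moment (`exists_rfiStep_eq_self`).

For arbitrary initial laws the cost `d²` may be infinite, so `min 1 d` replaces it. Along the
product coupling with `π` its integral tends to `0` by dominated convergence, and it controls
bounded Lipschitz test functions (`tendsto_integral_iterate_rfiStep`). This gives weak convergence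
without moments, and hence uniqueness. -/

theorem ENNReal.add_sq_le_two_mul (a b : ℝ≥0∞) : (a + b) ^ 2 ≤ 2 * (a ^ 2 + b ^ 2) := by
  have h := ENNReal.rpow_add_le_mul_rpow_add_rpow a b (p := 2) (by norm_num)
  norm_num at h
  exact_mod_cast h

theorem ENNReal.sq_rpow_half (a : ℝ≥0∞) : (a ^ 2) ^ (1 / 2 : ℝ) = a := by
  rw [← ENNReal.rpow_natCast, ← ENNReal.rpow_mul]
  norm_num

theorem ENNReal.rpow_half_sq (a : ℝ≥0∞) : (a ^ (1 / 2 : ℝ)) ^ 2 = a := by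
  rw [← ENNReal.rpow_natCast, ← ENNReal.rpow_mul]
  norm_num

theorem lintegral_sq_le_lintegral_sq {α : Type*} [MeasurableSpace α] (μ : Measure α)
    [IsProbabilityMeasure μ] {f : α → ℝ≥0∞} (hf : AEMeasurable f μ) :
    (∫⁻ a, f a ∂μ) ^ 2 ≤ ∫⁻ a, f a ^ 2 ∂μ := by
  have h := ENNReal.lintegral_mul_le_Lp_mul_Lq μ Real.HolderConjugate.two_two hf
    (aemeasurable_const (b := (1 : ℝ≥0∞)))
  simp only [Pi.mul_apply, mul_one, ENNReal.one_rpow, lintegral_const, measure_univ] at h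
  calc (∫⁻ a, f a ∂μ) ^ 2 ≤ ((∫⁻ a, f a ^ (2 : ℝ) ∂μ) ^ (1 / 2 : ℝ)) ^ 2 := by gcongr
    _ = ∫⁻ a, f a ^ 2 ∂μ := by rw [ENNReal.rpow_half_sq]; simp

theorem lintegral_add_sq_rpow_half_le {α : Type*} [MeasurableSpace α] {μ : Measure α}
    {f g : α → ℝ≥0∞} (hf : AEMeasurable f μ) (hg : AEMeasurable g μ) :
    (∫⁻ a, (f a + g a) ^ 2 ∂μ) ^ (1 / 2 : ℝ)
      ≤ (∫⁻ a, f a ^ 2 ∂μ) ^ (1 / 2 : ℝ) + (∫⁻ a, g a ^ 2 ∂μ) ^ (1 / 2 : ℝ) := by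
  simpa using ENNReal.lintegral_Lp_add_le hf hg (p := 2) (by norm_num)

theorem MemP2.lintegral_lt_top {G : Type*} [MeasurableSpace G] [PseudoEMetricSpace G]
    [OpensMeasurableSpace G] {μ : Measure G} (h : MemP2 μ) {x : G}
    (hx : ∀ y, edist x y ≠ ∞) : ∫⁻ y, edist x y ^ 2 ∂μ < ∞ := by
  obtain ⟨hμ, x₀, h₀⟩ := h
  calc ∫⁻ y, edist x y ^ 2 ∂μ ≤ ∫⁻ y, 2 * (edist x x₀ ^ 2 + edist x₀ y ^ 2) ∂μ :=
        lintegral_mono fun y =>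
          (pow_le_pow_left₀ zero_le (edist_triangle x x₀ y) 2).trans (ENNReal.add_sq_le_two_mul _ _)
    _ = 2 * (edist x x₀ ^ 2 + ∫⁻ y, edist x₀ y ^ 2 ∂μ) := by
        rw [lintegral_const_mul' _ _ (by simp), lintegral_add_left measurable_const]
        simp
    _ < ∞ := ENNReal.mul_lt_top (by simp)
        (ENNReal.add_lt_top.2 ⟨ENNReal.pow_lt_top (hx x₀).lt_top, h₀⟩)

/-! ### Couplings and the Wasserstein distance -/

theorem isCoupling_prod {G : Type*} [MeasurableSpace G] (μ ν : Measure G)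
    [IsProbabilityMeasure μ] [IsProbabilityMeasure ν] : IsCoupling (μ.prod ν) μ ν := by
  simp [IsCoupling]

theorem W2_lt_top {G : Type*} [MeasurableSpace G] [MetricSpace G] [BorelSpace G]
    [SecondCountableTopology G] {μ ν : Measure G} (hμ : MemP2 μ) (hν : MemP2 ν) :
    W2 μ ν < ∞ := by
  have := hμ.1
  have := hν.1
  obtain ⟨x, hx⟩ := hμ.2
  have hy := hν.lintegral_lt_top (x := x) fun y => edist_ne_top x y
  refine ENNReal.rpow_lt_top_of_nonneg (by norm_num) (ne_of_lt ?_)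
  refine lt_of_le_of_lt (iInf₂_le (μ.prod ν) (isCoupling_prod μ ν)) ?_
  calc ∫⁻ p, edist p.1 p.2 ^ 2 ∂(μ.prod ν)
      ≤ ∫⁻ p, 2 * (edist x p.1 ^ 2 + edist x p.2 ^ 2) ∂(μ.prod ν) :=
        lintegral_mono fun p =>
          (pow_le_pow_left₀ zero_le (edist_triangle_left p.1 p.2 x) 2).trans
            (ENNReal.add_sq_le_two_mul _ _)
    _ = 2 * (∫⁻ y, edist x y ^ 2 ∂μ + ∫⁻ y, edist x y ^ 2 ∂ν) := by
        rw [lintegral_const_mul' _ _ (by simp), lintegral_add_left (by fun_prop),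
          lintegral_prod _ (by fun_prop), lintegral_prod _ (by fun_prop)]
        simp
    _ < ∞ := ENNReal.mul_lt_top (by simp) (ENNReal.add_lt_top.2 ⟨hx, hy⟩)

theorem IsCoupling.isProbabilityMeasure {G : Type*} [MeasurableSpace G]
    {γ : Measure (G × G)} {μ ν : Measure G}
    [hμ : IsProbabilityMeasure μ] (h : IsCoupling γ μ ν) : IsProbabilityMeasure γ := by
  obtain ⟨rfl, _⟩ := h
  exact Measure.isProbabilityMeasure_of_map Prod.fst

/-- Pointwise, `|f x - f y| ≤ min C (L d) ≤ max C L * min 1 d`; integrate this along the coupling.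
-/
theorem edist_integral_le_of_isCoupling {G : Type*} [MetricSpace G] [MeasurableSpace G]
    [BorelSpace G] {γ : Measure (G × G)} {μ ν : Measure G}
    [IsProbabilityMeasure μ] [IsProbabilityMeasure ν] (hγ : IsCoupling γ μ ν) {f : G → ℝ} {C : ℝ}
    (hC : ∀ x y, dist (f x) (f y) ≤ C) {L : NNReal} (hL : LipschitzWith L f) :
    edist (∫ x, f x ∂μ) (∫ x, f x ∂ν)
      ≤ max (ENNReal.ofReal C) L * ∫⁻ p, min 1 (edist p.1 p.2) ∂γ := by
  have := hγ.isProbabilityMeasure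
  have hm : Measurable f := hL.continuous.measurable
  have hint : ∀ (κ : Measure G) [IsProbabilityMeasure κ], Integrable f κ := by
    intro κ hκ
    obtain ⟨x⟩ := κ.nonempty_of_neZero
    refine Integrable.of_bound (C := C + ‖f x‖) hm.aestronglyMeasurable (.of_forall fun y => ?_)
    have h1 := hC y x
    have h2 := norm_sub_norm_le (f y) (f x)
    rw [dist_eq_norm] at h1
    linarith
  have h1 : Integrable (fun p : G × G => f p.1) γ := by
    have := hint μ
    rw [← hγ.1] at this
    exact this.comp_measurable measurable_fst
  have h2 : Integrable (fun p : G × G => f p.2) γ := by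
    have := hint ν
    rw [← hγ.2] at this
    exact this.comp_measurable measurable_snd
  have e1 : ∫ x, f x ∂μ = ∫ p, f p.1 ∂γ := by
    rw [← hγ.1, integral_map (by fun_prop) hm.aestronglyMeasurable]
  have e2 : ∫ x, f x ∂ν = ∫ p, f p.2 ∂γ := by
    rw [← hγ.2, integral_map (by fun_prop) hm.aestronglyMeasurable]
  rw [e1, e2, edist_eq_enorm_sub, ← integral_sub h1 h2,
    ← lintegral_const_mul' _ _ (by simp)]
  refine (enorm_integral_le_lintegral_enorm _).trans (lintegral_mono fun p => ?_)
  rw [← edist_eq_enorm_sub, mul_min, mul_one]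
  refine le_min (le_trans ?_ (le_max_left _ _)) ((hL p.1 p.2).trans ?_)
  · rw [edist_dist]
    exact ENNReal.ofReal_le_ofReal (hC _ _)
  · gcongr
    exact le_max_right _ _

/-! ### One step of a random function iteration -/

/-- The law of `T i x` for independent `x` with law `μ` and `i` with law `ρ`. -/
noncomputable def rfiStep {G I : Type*} [MeasurableSpace G] [MeasurableSpace I]
    (T : I → G → G) (ρ : Measure I) (μ : Measure G) : Measure G :=
  (μ.prod ρ).map fun q => T q.2 q.1

section Step

variable {G I : Type*} [MeasurableSpace G] [MeasurableSpace I] {T : I → G → G}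
  {ρ : Measure I} [IsProbabilityMeasure ρ]

theorem bind_rfiKernel (hT : Measurable fun q : G × I => T q.2 q.1) (μ : Measure G) [SFinite μ] :
    μ.bind (rfiKernel T hT ρ) = rfiStep T ρ μ := by
  ext A hA
  rw [Measure.bind_apply hA (Kernel.aemeasurable _), rfiStep, Measure.map_apply hT hA,
    Measure.prod_apply (hT hA)]
  refine lintegral_congr fun x => ?_
  exact Measure.map_apply (hT.comp measurable_prodMk_left) hA

theorem isProbabilityMeasure_rfiStep (hT : Measurable fun q : G × I => T q.2 q.1)
    (μ : Measure G) [IsProbabilityMeasure μ] : IsProbabilityMeasure (rfiStep T ρ μ) :=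
  Measure.isProbabilityMeasure_map hT.aemeasurable

theorem isProbabilityMeasure_iterate_rfiStep (hT : Measurable fun q : G × I => T q.2 q.1)
    (μ : Measure G) [hμ : IsProbabilityMeasure μ] (k : ℕ) :
    IsProbabilityMeasure ((rfiStep T ρ)^[k] μ) := by
  induction k with
  | zero => exact hμ
  | succ k ih =>
    rw [Function.iterate_succ_apply']
    exact isProbabilityMeasure_rfiStep hT _

theorem lintegral_rfiStep (hT : Measurable fun q : G × I => T q.2 q.1) (μ : Measure G) [SFinite μ]
    {f : G → ℝ≥0∞} (hf : Measurable f) :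
    ∫⁻ y, f y ∂(rfiStep T ρ μ) = ∫⁻ x, ∫⁻ i, f (T i x) ∂ρ ∂μ := by
  rw [rfiStep, lintegral_map hf hT, lintegral_prod (fun q => f (T q.2 q.1))
      (hf.comp hT).aemeasurable]

/-- A measurable semiconjugacy between two families of maps intertwines their steps. -/
theorem map_rfiStep {H : Type*} [MeasurableSpace H] {S : I → H → H} {φ : H → G}
    (hφ : Measurable φ) (hT : Measurable fun q : G × I => T q.2 q.1)
    (hS : Measurable fun q : H × I => S q.2 q.1) (h : ∀ i x, φ (S i x) = T i (φ x))
    (μ : Measure H) [SFinite μ] : (rfiStep S ρ μ).map φ = rfiStep T ρ (μ.map φ) := by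
  have := Measure.map_prod_map μ ρ hφ measurable_id
  rw [Measure.map_id] at this
  rw [rfiStep, rfiStep, this, Measure.map_map hφ hS,
    Measure.map_map hT (hφ.prodMap measurable_id)]
  congr 1
  ext q
  exact h _ _

/-- The maps `T i` acting diagonally on pairs. -/
def diagMap (T : I → G → G) (i : I) (p : G × G) : G × G := (T i p.1, T i p.2)

theorem measurable_diagMap (hT : Measurable fun q : G × I => T q.2 q.1) :
    Measurable fun q : (G × G) × I => diagMap T q.2 q.1 :=
  (hT.comp ((measurable_fst.comp measurable_fst).prodMk measurable_snd)).prodMk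
    (hT.comp ((measurable_snd.comp measurable_fst).prodMk measurable_snd))

/-- Both coordinate projections semiconjugate the diagonal action to `T`. -/
theorem IsCoupling.rfiStep (hT : Measurable fun q : G × I => T q.2 q.1) {γ : Measure (G × G)}
    [SFinite γ] {μ ν : Measure G} (h : IsCoupling γ μ ν) :
    IsCoupling (rfiStep (diagMap T) ρ γ) (rfiStep T ρ μ) (rfiStep T ρ ν) := by
  obtain ⟨rfl, rfl⟩ := h
  exact ⟨map_rfiStep measurable_fst hT (measurable_diagMap hT) (fun _ _ => rfl) γ,
    map_rfiStep measurable_snd hT (measurable_diagMap hT) (fun _ _ => rfl) γ⟩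

theorem IsCoupling.iterate_rfiStep (hT : Measurable fun q : G × I => T q.2 q.1)
    {γ : Measure (G × G)} [IsProbabilityMeasure γ] {μ ν : Measure G} (h : IsCoupling γ μ ν)
    (k : ℕ) :
    IsCoupling ((_root_.rfiStep (diagMap T) ρ)^[k] γ) ((_root_.rfiStep T ρ)^[k] μ)
      ((_root_.rfiStep T ρ)^[k] ν) := by
  induction k with
  | zero => exact h
  | succ k ih =>
    simp only [Function.iterate_succ_apply']
    have := isProbabilityMeasure_iterate_rfiStep (ρ := ρ) (measurable_diagMap hT) γ k
    exact ih.rfiStep hT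

end Step

/-! ### Mean-square contractions -/

section Contraction

variable {G I : Type*} [MetricSpace G] [SecondCountableTopology G] [MeasurableSpace G]
  [BorelSpace G] [MeasurableSpace I] {T : I → G → G} {ρ : Measure I} [IsProbabilityMeasure ρ]
  {r : ℝ≥0∞}

theorem W2_rfiStep_le (hT : Measurable fun q : G × I => T q.2 q.1) (hr : r ≠ ∞)
    (hc : ∀ x y, ∫⁻ i, edist (T i x) (T i y) ^ 2 ∂ρ ≤ r ^ 2 * edist x y ^ 2)
    (μ ν : Measure G) [IsProbabilityMeasure μ] [IsProbabilityMeasure ν] :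
    W2 (rfiStep T ρ μ) (rfiStep T ρ ν) ≤ r * W2 μ ν := by
  have key : ∀ γ, IsCoupling γ μ ν →
      (⨅ (γ' : Measure (G × G)) (_ : IsCoupling γ' (rfiStep T ρ μ) (rfiStep T ρ ν)),
        ∫⁻ p, edist p.1 p.2 ^ 2 ∂γ') ≤ r ^ 2 * ∫⁻ p, edist p.1 p.2 ^ 2 ∂γ := by
    intro γ hγ
    have := hγ.isProbabilityMeasure
    refine le_trans (iInf₂_le (rfiStep (diagMap T) ρ γ) (hγ.rfiStep hT)) ?_
    rw [lintegral_rfiStep (measurable_diagMap hT) γ (by fun_prop),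
      ← lintegral_const_mul' _ _ (ENNReal.pow_ne_top hr)]
    exact lintegral_mono fun p => hc p.1 p.2
  rw [W2, W2]
  refine (ENNReal.rpow_le_rpow (z := 1 / 2) (?_ : _ ≤ r ^ 2 *
    ⨅ (γ : Measure (G × G)) (_ : IsCoupling γ μ ν), ∫⁻ p, edist p.1 p.2 ^ 2 ∂γ)
    (by norm_num)).trans_eq ?_
  -- A zero factor cannot be moved inside an infimum that may be `∞`. For `r = 0` the product
  -- coupling already bounds the new cost by `0`, since `0 * ∞ = 0`.
  · rcases eq_or_ne r 0 with rfl | h0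
    · refine (key _ (isCoupling_prod μ ν)).trans ?_
      simp
    · simp_rw [ENNReal.mul_iInf_of_ne (pow_ne_zero 2 h0) (ENNReal.pow_ne_top hr)]
      exact le_iInf₂ key
  · rw [ENNReal.mul_rpow_of_nonneg _ _ (by norm_num), ENNReal.sq_rpow_half]

theorem lintegral_edist_le_of_sq (hT : Measurable fun q : G × I => T q.2 q.1)
    (hc : ∀ x y, ∫⁻ i, edist (T i x) (T i y) ^ 2 ∂ρ ≤ r ^ 2 * edist x y ^ 2) (x y : G) :
    ∫⁻ i, edist (T i x) (T i y) ∂ρ ≤ r * edist x y := by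
  have hx : ∀ x, Measurable fun i => T i x := fun x => hT.comp measurable_prodMk_left
  refine (ENNReal.pow_right_strictMono two_ne_zero).le_iff_le.1 ?_
  simp only [mul_pow]
  exact (lintegral_sq_le_lintegral_sq ρ ((hx x).edist (hx y)).aemeasurable).trans (hc x y)

/-- Jensen for the concave function `min 1`. The scale `s` lets each step turn into a factor `r`
inside the truncation, where it can be iterated. -/
theorem lintegral_min_one_mul_edist_rfiStep_le (hT : Measurable fun q : G × I => T q.2 q.1)
    (hc : ∀ x y, ∫⁻ i, edist (T i x) (T i y) ∂ρ ≤ r * edist x y)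
    (γ : Measure (G × G)) [SFinite γ] {s : ℝ≥0∞} (hs : s ≠ ∞) :
    ∫⁻ p, min 1 (s * edist p.1 p.2) ∂(rfiStep (diagMap T) ρ γ)
      ≤ ∫⁻ p, min 1 (s * r * edist p.1 p.2) ∂γ := by
  rw [lintegral_rfiStep (measurable_diagMap hT) γ (by fun_prop)]
  refine lintegral_mono fun p => le_min ?_ ?_
  · exact (lintegral_mono fun i => min_le_left _ _).trans (by simp)
  · refine (lintegral_mono fun i => min_le_right _ _).trans ?_
    rw [lintegral_const_mul' _ _ hs, mul_assoc]
    exact mul_le_mul_right (hc p.1 p.2) s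

theorem lintegral_min_one_edist_iterate_rfiStep_le
    (hT : Measurable fun q : G × I => T q.2 q.1) (hr : r ≠ ∞)
    (hc : ∀ x y, ∫⁻ i, edist (T i x) (T i y) ∂ρ ≤ r * edist x y)
    (γ : Measure (G × G)) [IsProbabilityMeasure γ] (k : ℕ) (s : ℝ≥0∞) (hs : s ≠ ∞) :
    ∫⁻ p, min 1 (s * edist p.1 p.2) ∂((rfiStep (diagMap T) ρ)^[k] γ)
      ≤ ∫⁻ p, min 1 (s * r ^ k * edist p.1 p.2) ∂γ := by
  induction k generalizing s with
  | zero => simp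
  | succ k ih =>
    rw [Function.iterate_succ_apply']
    have := isProbabilityMeasure_iterate_rfiStep (ρ := ρ) (measurable_diagMap hT) γ k
    refine (lintegral_min_one_mul_edist_rfiStep_le hT hc _ hs).trans ?_
    refine (ih (s * r) (ENNReal.mul_ne_top hs hr)).trans_eq ?_
    simp only [pow_succ', mul_assoc]

theorem tendsto_lintegral_min_one_edist_iterate_rfiStep
    (hT : Measurable fun q : G × I => T q.2 q.1) (hr : r < 1)
    (hc : ∀ x y, ∫⁻ i, edist (T i x) (T i y) ∂ρ ≤ r * edist x y)
    (γ : Measure (G × G)) [IsProbabilityMeasure γ] :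
    Tendsto (fun k => ∫⁻ p, min 1 (edist p.1 p.2) ∂((rfiStep (diagMap T) ρ)^[k] γ))
      atTop (𝓝 0) := by
  have hlim : Tendsto (fun k => ∫⁻ p : G × G, min 1 (r ^ k * edist p.1 p.2) ∂γ) atTop
      (𝓝 (∫⁻ _, 0 ∂γ)) := by
    refine tendsto_lintegral_of_dominated_convergence (fun _ => 1) (fun k => by fun_prop)
      (fun k => .of_forall fun p => min_le_left _ _) (by simp) (.of_forall fun p => ?_)
    have h1 : Tendsto (fun k => r ^ k * edist p.1 p.2) atTop (𝓝 (0 * edist p.1 p.2)) :=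
      ENNReal.Tendsto.mul_const (ENNReal.tendsto_pow_atTop_nhds_zero_of_lt_one hr)
        (.inr (edist_ne_top _ _))
    rw [zero_mul] at h1
    simpa using (tendsto_const_nhds (x := (1 : ℝ≥0∞))).min h1
  rw [lintegral_zero] at hlim
  refine tendsto_of_tendsto_of_tendsto_of_le_of_le tendsto_const_nhds hlim
    (fun _ => zero_le) fun k => ?_
  simpa using lintegral_min_one_edist_iterate_rfiStep_le hT hr.ne_top hc γ k 1 (by simp)

theorem tendsto_integral_iterate_rfiStep (hT : Measurable fun q : G × I => T q.2 q.1) (hr : r < 1)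
    (hc : ∀ x y, ∫⁻ i, edist (T i x) (T i y) ∂ρ ≤ r * edist x y)
    (μ π : Measure G) [IsProbabilityMeasure μ] [IsProbabilityMeasure π] (hπ : rfiStep T ρ π = π)
    (f : BoundedContinuousFunction G ℝ) :
    Tendsto (fun k => ∫ x, f x ∂((rfiStep T ρ)^[k] μ)) atTop (𝓝 (∫ x, f x ∂π)) := by
  have hprob := isProbabilityMeasure_iterate_rfiStep (ρ := ρ) hT μ
  let μs : ℕ → ProbabilityMeasure G := fun k => ⟨(rfiStep T ρ)^[k] μ, hprob k⟩
  have hμs : Tendsto μs atTop (𝓝 (⟨π, inferInstance⟩ : ProbabilityMeasure G)) := by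
    -- Bounded Lipschitz functions determine weak convergence.
    refine tendsto_iff_forall_lipschitz_integral_tendsto.2 ?_
    rintro f ⟨C, hC⟩ ⟨L, hL⟩
    rw [tendsto_iff_edist_tendsto_0]
    have h0 := ENNReal.Tendsto.const_mul (a := max (ENNReal.ofReal C) (L : ℝ≥0∞))
      (tendsto_lintegral_min_one_edist_iterate_rfiStep hT hr hc (μ.prod π)) (.inr (by simp))
    rw [mul_zero] at h0
    refine tendsto_of_tendsto_of_tendsto_of_le_of_le tendsto_const_nhds h0
      (fun _ => zero_le) fun k => ?_
    have hγ := (isCoupling_prod μ π).iterate_rfiStep (ρ := ρ) hT k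
    rw [Function.iterate_fixed hπ] at hγ
    exact edist_integral_le_of_isCoupling hγ hC hL
  exact ProbabilityMeasure.tendsto_iff_forall_integral_tendsto.1 hμs f

/-- The iterates of `μ` are constant, yet they converge weakly to `π`. -/
theorem eq_of_rfiStep_eq_self (hT : Measurable fun q : G × I => T q.2 q.1) (hr : r < 1)
    (hc : ∀ x y, ∫⁻ i, edist (T i x) (T i y) ∂ρ ≤ r * edist x y)
    (μ π : Measure G) [IsProbabilityMeasure μ] [IsProbabilityMeasure π]
    (hμ : rfiStep T ρ μ = μ) (hπ : rfiStep T ρ π = π) : μ = π := by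
  refine ext_of_forall_integral_eq_of_IsFiniteMeasure fun f => ?_
  have h := tendsto_integral_iterate_rfiStep hT hr hc μ π hπ f
  simp only [Function.iterate_fixed hμ] at h
  exact tendsto_nhds_unique tendsto_const_nhds h

end Contraction

/-! ### Sequences of independent indices -/

section Sequence

variable {I : Type*}

/-- The sequence with first term `q.1`, followed by the sequence `q.2`. -/
def consSeq (q : I × (ℕ → I)) : ℕ → I
  | 0 => q.1
  | n + 1 => q.2 n

theorem measurable_consSeq [MeasurableSpace I] : Measurable (consSeq (I := I)) := by
  refine measurable_pi_iff.2 fun n => ?_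
  cases n with
  | zero => exact measurable_fst
  | succ n => exact (measurable_pi_apply n).comp measurable_snd

/-- This replaces Markov-property arguments: a fresh index put in front of an i.i.d. sequence gives
an i.i.d. sequence. It is checked on finite cylinders. -/
theorem map_consSeq [MeasurableSpace I] (ρ : Measure I) [IsProbabilityMeasure ρ] :
    (ρ.prod (Measure.infinitePi fun _ : ℕ => ρ)).map consSeq
      = Measure.infinitePi fun _ : ℕ => ρ := by
  classical
  refine Measure.eq_infinitePi _ fun s t ht => ?_
  obtain ⟨N, hN⟩ := s.exists_nat_subset_range
  have hs : s ⊆ Finset.range (N + 1) := hN.trans (Finset.range_mono N.le_succ)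
  -- Padding with `univ` makes the cylinder a box over `range (N + 1)`, so that index `0` always
  -- splits off.
  set t' : ℕ → Set I := fun i => if i ∈ s then t i else Set.univ with ht'
  have hmt' : ∀ i, MeasurableSet (t' i) := fun i => by
    by_cases h : i ∈ s <;> simp [ht', h, ht i]
  have hpre : consSeq ⁻¹' Set.pi (s : Set ℕ) t
      = t' 0 ×ˢ Set.pi (Finset.range N : Set ℕ) fun i => t' (i + 1) := by
    ext q
    simp only [Set.mem_preimage, Set.mem_pi, Set.mem_prod, Finset.mem_coe, Finset.mem_range]
    constructor
    · intro h
      refine ⟨?_, fun i _ => ?_⟩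
      · by_cases h0 : 0 ∈ s
        · simpa [ht', h0] using! h 0 h0
        · simp [ht', h0]
      · by_cases h0 : i + 1 ∈ s
        · simpa [ht', h0] using! h (i + 1) h0
        · simp [ht', h0]
    · rintro ⟨h0, h1⟩ i hi
      cases i with
      | zero => simpa [ht', hi] using! h0
      | succ i =>
        have := h1 i (by have := Finset.mem_range.1 (hs hi); omega)
        simpa [ht', hi] using! this
  rw [Measure.map_apply measurable_consSeq
      (MeasurableSet.pi s.countable_toSet fun i _ => ht i), hpre, Measure.prod_prod,
    Measure.infinitePi_pi _ fun i _ => hmt' (i + 1), mul_comm,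
    ← Finset.prod_range_succ' (fun i => ρ (t' i)), ← Finset.prod_subset hs]
  · exact Finset.prod_congr rfl fun i hi => by simp [ht', hi]
  · intro i _ hi
    simp [ht', hi]

end Sequence

/-! ### Forward iteration -/

section Forward

variable {G I : Type*} {T : I → G → G}

/-- The forward iteration `T (ω (k - 1)) ∘ ⋯ ∘ T (ω 0)`. -/
def forwardIter (T : I → G → G) : ℕ → G × (ℕ → I) → G
  | 0, q => q.1
  | k + 1, q => T (q.2 k) (forwardIter T k q)

theorem forwardIter_consSeq (k : ℕ) (x : G) (i : I) (ω : ℕ → I) :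
    forwardIter T (k + 1) (x, consSeq (i, ω)) = forwardIter T k (T i x, ω) := by
  induction k with
  | zero => rfl
  | succ k ih => rw [forwardIter, ih]; rfl

variable [MeasurableSpace G] [MeasurableSpace I]

theorem measurable_forwardIter (hT : Measurable fun q : G × I => T q.2 q.1) (k : ℕ) :
    Measurable (forwardIter T k) := by
  induction k with
  | zero => exact measurable_fst
  | succ k ih => exact hT.comp (ih.prodMk ((measurable_pi_apply k).comp measurable_snd))

/-- The induction absorbs the first index into the initial law, not the last one into the final
step; hence `μ` is generalized. -/
theorem map_forwardIter {ρ : Measure I} [IsProbabilityMeasure ρ]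
    (hT : Measurable fun q : G × I => T q.2 q.1) (μ : Measure G) [IsProbabilityMeasure μ] (k : ℕ) :
    (μ.prod (Measure.infinitePi fun _ : ℕ => ρ)).map (forwardIter T k) = (rfiStep T ρ)^[k] μ := by
  induction k generalizing μ with
  | zero => exact Measure.map_fst_prod.trans (by simp)
  | succ k ih =>
    have := isProbabilityMeasure_rfiStep (ρ := ρ) hT μ
    have hF := measurable_forwardIter hT
    rw [Function.iterate_succ_apply, ← ih, rfiStep]
    conv_lhs => rw [← map_consSeq ρ]
    have h1 := Measure.map_prod_map μ (ρ.prod (Measure.infinitePi fun _ : ℕ => ρ))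
      measurable_id measurable_consSeq
    have h2 := Measure.map_prod_map (μ.prod ρ) (Measure.infinitePi fun _ : ℕ => ρ)
      hT measurable_id
    rw [Measure.map_id] at h1 h2
    rw [h1, h2, ← Measure.prodAssoc_prod,
      Measure.map_map (measurable_id.prodMap measurable_consSeq) MeasurableEquiv.prodAssoc.measurable,
      Measure.map_map (hF _) ((measurable_id.prodMap measurable_consSeq).comp
        MeasurableEquiv.prodAssoc.measurable),
      Measure.map_map (hF _) (hT.prodMap measurable_id)]
    congr 1
    ext q
    exact forwardIter_consSeq k q.1.1 q.1.2 q.2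

/-- The laws of a random function iteration. -/
theorem IsRFI.map_eq {Ω : Type*} [MeasurableSpace Ω] {ρ : Measure I} [IsProbabilityMeasure ρ]
    {Q : Measure Ω} [IsProbabilityMeasure Q] {η : ℕ → Ω → I} {X : ℕ → Ω → G}
    (hT : Measurable fun q : G × I => T q.2 q.1) (h : IsRFI T ρ Q η X) (k : ℕ) :
    Q.map (X k) = (rfiStep T ρ)^[k] (Q.map (X 0)) := by
  have hη : Measurable fun ω k => η k ω := measurable_pi_iff.2 h.measurable_index
  have hlaw : Q.map (fun ω k => η k ω) = Measure.infinitePi fun _ : ℕ => ρ := by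
    rw [h.indep_index.map_fun_eq_infinitePi_map h.measurable_index]
    simp_rw [h.law_index]
  have := Measure.isProbabilityMeasure_map (μ := Q) h.measurable_init.aemeasurable
  have hX : X k =ᵐ[Q] fun ω => forwardIter T k (X 0 ω, fun k => η k ω) := by
    induction k with
    | zero => rfl
    | succ k ih =>
      filter_upwards [ih, h.step k] with ω h1 h2
      rw [h2, h1]
      rfl
  rw [Measure.map_congr hX, ← map_forwardIter hT, ← hlaw,
    ← (indepFun_iff_map_prod_eq_prod_map_map h.measurable_init.aemeasurable
      hη.aemeasurable).1 h.indep_init,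
    Measure.map_map (measurable_forwardIter hT k) (h.measurable_init.prodMk hη)]
  rfl

end Forward

/-! ### Backward iteration and existence of the invariant measure -/

section Backward

variable {G I : Type*} {T : I → G → G} {x₀ : G}

/-- The backward iteration `T (ω 0) ∘ ⋯ ∘ T (ω (k - 1))`, started at `x₀`. -/
def backwardIter (T : I → G → G) (x₀ : G) : ℕ → (ℕ → I) → G
  | 0, _ => x₀
  | k + 1, ω => T (ω 0) (backwardIter T x₀ k fun j => ω (j + 1))

theorem backwardIter_succ_consSeq (k : ℕ) (q : I × (ℕ → I)) :
    backwardIter T x₀ (k + 1) (consSeq q) = T q.1 (backwardIter T x₀ k q.2) := rfl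

variable [MeasurableSpace I]

theorem measurable_backwardIter [MeasurableSpace G] (hT : Measurable fun q : G × I => T q.2 q.1)
    (k : ℕ) : Measurable (backwardIter T x₀ k) := by
  induction k with
  | zero => exact measurable_const
  | succ k ih =>
    exact hT.comp ((ih.comp (measurable_pi_iff.2 fun j => measurable_pi_apply (j + 1))).prodMk
      (measurable_pi_apply 0))

theorem lintegral_infinitePi_eq_consSeq (ρ : Measure I) [IsProbabilityMeasure ρ]
    {f : (ℕ → I) → ℝ≥0∞} (hf : Measurable f) :
    ∫⁻ ω, f ω ∂(Measure.infinitePi fun _ : ℕ => ρ)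
      = ∫⁻ ω, ∫⁻ i, f (consSeq (i, ω)) ∂ρ ∂(Measure.infinitePi fun _ : ℕ => ρ) := by
  conv_lhs => rw [← map_consSeq ρ]
  rw [lintegral_map hf measurable_consSeq,
    lintegral_prod_symm (fun q => f (consSeq q)) (hf.comp measurable_consSeq).aemeasurable]

variable [MetricSpace G] [SecondCountableTopology G] [MeasurableSpace G]
  [BorelSpace G] {ρ : Measure I} [IsProbabilityMeasure ρ] {r : ℝ≥0∞}

/-- Successive backward iterates share their outermost map, whose index is independent of the rest;
averaging over it first gains a factor `r`. -/
theorem lintegral_edist_backwardIter_succ_le (hT : Measurable fun q : G × I => T q.2 q.1)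
    (hr : r ≠ ∞) (hc : ∀ x y, ∫⁻ i, edist (T i x) (T i y) ∂ρ ≤ r * edist x y) (k : ℕ) :
    ∫⁻ ω, edist (backwardIter T x₀ k ω) (backwardIter T x₀ (k + 1) ω)
        ∂(Measure.infinitePi fun _ : ℕ => ρ)
      ≤ r ^ k * ∫⁻ i, edist x₀ (T i x₀) ∂ρ := by
  have hZ := measurable_backwardIter (x₀ := x₀) hT
  induction k with
  | zero =>
    rw [lintegral_infinitePi_eq_consSeq ρ ((hZ 0).edist (hZ 1))]
    simp [backwardIter, consSeq]
  | succ k ih =>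
    rw [lintegral_infinitePi_eq_consSeq ρ ((hZ _).edist (hZ _))]
    simp_rw [backwardIter_succ_consSeq]
    refine (lintegral_mono fun ω => hc _ _).trans ?_
    rw [lintegral_const_mul' _ _ hr, pow_succ', mul_assoc]
    exact mul_le_mul_right ih r

/-- The expected total length of the path is bounded by a geometric series, so the length is almost
surely finite. -/
theorem ae_cauchySeq_backwardIter (hT : Measurable fun q : G × I => T q.2 q.1)
    (hr : r < 1) (hc : ∀ x y, ∫⁻ i, edist (T i x) (T i y) ∂ρ ≤ r * edist x y)
    (hm : ∫⁻ i, edist x₀ (T i x₀) ∂ρ ≠ ∞) :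
    ∀ᵐ ω ∂(Measure.infinitePi fun _ : ℕ => ρ), CauchySeq fun k => backwardIter T x₀ k ω := by
  have hZ := measurable_backwardIter (x₀ := x₀) hT
  have hd : ∀ k, Measurable fun ω => edist (backwardIter T x₀ k ω) (backwardIter T x₀ (k + 1) ω) :=
    fun k => (hZ k).edist (hZ _)
  have hfin : ∫⁻ ω, ∑' k, edist (backwardIter T x₀ k ω) (backwardIter T x₀ (k + 1) ω)
      ∂(Measure.infinitePi fun _ : ℕ => ρ) ≠ ∞ := by
    rw [lintegral_tsum fun k => (hd k).aemeasurable]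
    refine ne_top_of_le_ne_top ?_
      (ENNReal.tsum_le_tsum (lintegral_edist_backwardIter_succ_le hT hr.ne_top hc))
    rw [ENNReal.tsum_mul_right, ENNReal.tsum_geometric]
    exact ENNReal.mul_ne_top (ENNReal.inv_ne_top.2 (tsub_pos_of_lt hr).ne') hm
  filter_upwards [ae_lt_top (Measurable.tsum hd) hfin] with ω hω
  exact cauchySeq_of_edist_le_of_tsum_ne_top _ (fun _ => le_rfl) hω.ne

/-- Minkowski through the intermediate point `T i x₀` gives `t ↦ m + r t` for successive `L²` norms;
`m / (1 - r)` is the fixed point of this map. -/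
theorem lintegral_edist_sq_backwardIter_rpow_le (hT : Measurable fun q : G × I => T q.2 q.1)
    (hr : r < 1) (hc : ∀ x y, ∫⁻ i, edist (T i x) (T i y) ^ 2 ∂ρ ≤ r ^ 2 * edist x y ^ 2) (k : ℕ) :
    (∫⁻ ω, edist x₀ (backwardIter T x₀ k ω) ^ 2
        ∂(Measure.infinitePi fun _ : ℕ => ρ)) ^ (1 / 2 : ℝ)
      ≤ (1 - r)⁻¹ * (∫⁻ i, edist x₀ (T i x₀) ^ 2 ∂ρ) ^ (1 / 2 : ℝ) := by
  have hZ := measurable_backwardIter (x₀ := x₀) hT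
  have hTx : ∀ x, Measurable fun i => T i x := fun x => hT.comp measurable_prodMk_left
  set m := (∫⁻ i, edist x₀ (T i x₀) ^ 2 ∂ρ) ^ (1 / 2 : ℝ) with hm
  set Pρ := Measure.infinitePi fun _ : ℕ => ρ with hPρ
  induction k with
  | zero => simp [backwardIter]
  | succ k ih =>
    have hprod : ∫⁻ ω, edist x₀ (backwardIter T x₀ (k + 1) ω) ^ 2 ∂Pρ
        = ∫⁻ q, edist x₀ (T q.1 (backwardIter T x₀ k q.2)) ^ 2 ∂(ρ.prod Pρ) := by
      conv_lhs => rw [hPρ, ← map_consSeq ρ]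
      rw [lintegral_map (((measurable_const).edist (hZ _)).pow_const 2) measurable_consSeq]
      rfl
    have hTq : Measurable fun q : I × (ℕ → I) => T q.1 (backwardIter T x₀ k q.2) :=
      hT.comp (((hZ k).comp measurable_snd).prodMk measurable_fst)
    have hTq0 : Measurable fun q : I × (ℕ → I) => T q.1 x₀ := (hTx x₀).comp measurable_fst
    have h1 : ∫⁻ q, edist x₀ (T q.1 x₀) ^ 2 ∂(ρ.prod Pρ) = ∫⁻ i, edist x₀ (T i x₀) ^ 2 ∂ρ := by
      rw [lintegral_prod _ ((measurable_const.edist hTq0).pow_const 2).aemeasurable]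
      simp
    have h2 : ∫⁻ q, edist (T q.1 x₀) (T q.1 (backwardIter T x₀ k q.2)) ^ 2 ∂(ρ.prod Pρ)
        ≤ r ^ 2 * ∫⁻ ω, edist x₀ (backwardIter T x₀ k ω) ^ 2 ∂Pρ := by
      rw [lintegral_prod_symm _ ((hTq0.edist hTq).pow_const 2).aemeasurable,
        ← lintegral_const_mul' _ _ (ENNReal.pow_ne_top hr.ne_top)]
      exact lintegral_mono fun ω => hc _ _
    rw [hprod]
    calc (∫⁻ q, edist x₀ (T q.1 (backwardIter T x₀ k q.2)) ^ 2 ∂(ρ.prod Pρ)) ^ (1 / 2 : ℝ)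
        ≤ (∫⁻ q, (edist x₀ (T q.1 x₀) + edist (T q.1 x₀) (T q.1 (backwardIter T x₀ k q.2))) ^ 2
            ∂(ρ.prod Pρ)) ^ (1 / 2 : ℝ) := by
          refine ENNReal.rpow_le_rpow (lintegral_mono fun q => ?_) (by norm_num)
          exact pow_le_pow_left₀ zero_le (edist_triangle _ _ _) 2
      _ ≤ m + (r ^ 2 * ∫⁻ ω, edist x₀ (backwardIter T x₀ k ω) ^ 2 ∂Pρ) ^ (1 / 2 : ℝ) := by
          refine (lintegral_add_sq_rpow_half_le (measurable_const.edist hTq0).aemeasurable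
            (hTq0.edist hTq).aemeasurable).trans ?_
          rw [h1]
          gcongr
      _ ≤ m + r * ((1 - r)⁻¹ * m) := by
          rw [ENNReal.mul_rpow_of_nonneg _ _ (by norm_num), ENNReal.sq_rpow_half]
          gcongr
      _ = ((1 - r) + r) * ((1 - r)⁻¹ * m) := by
          rw [add_mul, ← mul_assoc (1 - r), ENNReal.mul_inv_cancel (tsub_pos_of_lt hr).ne'
            (by simp), one_mul]
      _ = (1 - r)⁻¹ * m := by rw [tsub_add_cancel_of_le hr.le, one_mul]

/-- A mean-square contraction has an invariant measure with finite second moment. -/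
theorem exists_rfiStep_eq_self [CompleteSpace G] (hT : Measurable fun q : G × I => T q.2 q.1)
    (hcont : ∀ i, Continuous (T i)) (hr : r < 1)
    (hc : ∀ x y, ∫⁻ i, edist (T i x) (T i y) ^ 2 ∂ρ ≤ r ^ 2 * edist x y ^ 2)
    (hm : ∫⁻ i, edist x₀ (T i x₀) ^ 2 ∂ρ ≠ ∞) :
    ∃ π : Measure G, rfiStep T ρ π = π ∧ MemP2 π := by
  have hZ := measurable_backwardIter (x₀ := x₀) hT
  have hTx : ∀ x, Measurable fun i => T i x := fun x => hT.comp measurable_prodMk_left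
  set Pρ := Measure.infinitePi fun _ : ℕ => ρ with hPρ
  have hm1 : ∫⁻ i, edist x₀ (T i x₀) ∂ρ ≠ ∞ := by
    have h := lintegral_sq_le_lintegral_sq ρ (measurable_const.edist (hTx x₀)).aemeasurable
      (f := fun i => edist x₀ (T i x₀))
    intro h'
    rw [h'] at h
    exact hm (top_le_iff.1 (by simpa using h))
  obtain ⟨Z, hZm, hZlim⟩ := measurable_limit_of_tendsto_metrizable_ae
    (fun k => (hZ k).aemeasurable (μ := Pρ))
    ((ae_cauchySeq_backwardIter hT hr (lintegral_edist_le_of_sq hT hc) hm1).mono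
      fun ω hω => cauchySeq_tendsto_of_complete hω)
  refine ⟨Pρ.map Z, ?_, Measure.isProbabilityMeasure_map hZm.aemeasurable, x₀, ?_⟩
  · have h1 : ∀ᵐ q ∂(ρ.prod Pρ),
        Tendsto (fun k => backwardIter T x₀ k (consSeq q)) atTop (𝓝 (Z (consSeq q))) := by
      refine ae_of_ae_map measurable_consSeq.aemeasurable (p := fun ω =>
        Tendsto (fun k => backwardIter T x₀ k ω) atTop (𝓝 (Z ω))) ?_
      rw [map_consSeq]
      exact hZlim
    have h2 : ∀ᵐ q ∂(ρ.prod Pρ),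
        Tendsto (fun k => backwardIter T x₀ k q.2) atTop (𝓝 (Z q.2)) :=
      Measure.quasiMeasurePreserving_snd.ae hZlim
    -- Passing to the limit in the backward recursion, by continuity of each map, shows that `Z`
    -- solves the stationarity equation pathwise.
    have h3 : (fun q => Z (consSeq q)) =ᵐ[ρ.prod Pρ] fun q => T q.1 (Z q.2) := by
      filter_upwards [h1, h2] with q h1 h2
      exact tendsto_nhds_unique ((tendsto_add_atTop_iff_nat 1).2 h1)
        (((hcont q.1).tendsto _).comp h2)
    have h4 : Pρ.map Z = (ρ.prod Pρ).map fun q => T q.1 (Z q.2) := by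
      rw [← Measure.map_congr h3, hPρ]
      conv_lhs => rw [← map_consSeq ρ]
      exact Measure.map_map hZm measurable_consSeq
    have h5 := Measure.map_prod_map Pρ ρ hZm measurable_id
    rw [Measure.map_id] at h5
    rw [rfiStep, h5, Measure.map_map hT (hZm.prodMap measurable_id), h4, ← Measure.prod_swap,
      Measure.map_map (hT.comp (hZm.prodMap measurable_id)) measurable_swap]
    rfl
  · rw [lintegral_map (by fun_prop) hZm]
    have h1 : ∫⁻ ω, edist x₀ (Z ω) ^ 2 ∂Pρ
        = ∫⁻ ω, liminf (fun k => edist x₀ (backwardIter T x₀ k ω) ^ 2) atTop ∂Pρ := by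
      refine lintegral_congr_ae ?_
      filter_upwards [hZlim] with ω hω
      exact (((ENNReal.continuous_pow 2).tendsto _).comp
        (tendsto_const_nhds.edist hω)).liminf_eq.symm
    rw [h1]
    -- Fatou transfers the uniform second-moment bound to the limit.
    refine (lintegral_liminf_le fun k => (measurable_const.edist (hZ k)).pow_const 2).trans_lt ?_
    have hb : ∀ k, ∫⁻ ω, edist x₀ (backwardIter T x₀ k ω) ^ 2 ∂Pρ
        ≤ ((1 - r)⁻¹ * (∫⁻ i, edist x₀ (T i x₀) ^ 2 ∂ρ) ^ (1 / 2 : ℝ)) ^ 2 := fun k => by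
      rw [← ENNReal.rpow_half_sq (∫⁻ ω, edist x₀ (backwardIter T x₀ k ω) ^ 2 ∂Pρ)]
      exact pow_le_pow_left₀ zero_le (lintegral_edist_sq_backwardIter_rpow_le hT hr hc k) 2
    refine ((liminf_le_liminf (.of_forall hb)).trans (liminf_const _).le).trans_lt ?_
    exact ENNReal.pow_lt_top (ENNReal.mul_lt_top
      (ENNReal.inv_lt_top.2 (tsub_pos_of_lt hr))
      (ENNReal.rpow_lt_top_of_nonneg (by norm_num) hm))

end Backward

/-! ### The projection onto a perturbed hyperplane -/

section NoisyProj

variable {n : ℕ} (a xbar : EuclideanSpace ℝ (Fin n))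

theorem continuous_noisyProj (e : EuclideanSpace ℝ (Fin n) × ℝ) :
    Continuous (noisyProj a xbar e) := by
  unfold noisyProj
  fun_prop

theorem norm_noisyProj_sub_sq (e : EuclideanSpace ℝ (Fin n) × ℝ)
    (x y : EuclideanSpace ℝ (Fin n)) :
    ‖noisyProj a xbar e x - noisyProj a xbar e y‖ ^ 2
      = ‖x - y‖ ^ 2 - inner ℝ (a + e.1) (x - y) ^ 2 / ‖a + e.1‖ ^ 2 := by
  have h : noisyProj a xbar e x - noisyProj a xbar e y
      = (x - y) - (inner ℝ (a + e.1) (x - y) / ‖a + e.1‖ ^ 2) • (a + e.1) := by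
    have h1 : inner ℝ (a + e.1) (x - y)
        = (inner ℝ (a + e.1) (x - xbar) - e.2) - (inner ℝ (a + e.1) (y - xbar) - e.2) := by
      simp only [inner_sub_right]
      ring
    rw [h1, sub_div (inner ℝ (a + e.1) (x - xbar) - e.2), sub_smul, noisyProj, noisyProj,
      sub_sub_sub_comm]
  rw [h, norm_sub_sq_real, inner_smul_right, real_inner_comm, norm_smul, mul_pow,
    Real.norm_eq_abs, sq_abs]
  -- Where `a + ξ = 0`, the quotients are `0` and the map is the identity, so the formula persists.
  rcases eq_or_ne (a + e.1) 0 with h0 | h0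
  · simp [h0]
  · have : ‖a + e.1‖ ≠ 0 := norm_ne_zero_iff.2 h0
    field_simp
    ring

theorem norm_sub_noisyProj_self_sq (e : EuclideanSpace ℝ (Fin n) × ℝ) :
    ‖xbar - noisyProj a xbar e xbar‖ ^ 2 = e.2 ^ 2 / ‖a + e.1‖ ^ 2 := by
  rw [noisyProj, sub_sub_cancel, sub_self, inner_zero_right, zero_sub, norm_smul, mul_pow,
    Real.norm_eq_abs, sq_abs]
  rcases eq_or_ne (a + e.1) 0 with h0 | h0
  · simp [h0]
  · have : ‖a + e.1‖ ≠ 0 := norm_ne_zero_iff.2 h0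
    field_simp

theorem inner_sq_div_norm_sq_le {E : Type*} [NormedAddCommGroup E] [InnerProductSpace ℝ E]
    (v w : E) : inner ℝ v w ^ 2 / ‖v‖ ^ 2 ≤ ‖w‖ ^ 2 := by
  refine div_le_of_le_mul₀ (sq_nonneg _) (sq_nonneg _) ?_
  rw [← mul_pow, ← sq_abs (inner ℝ v w), mul_comm]
  exact pow_le_pow_left₀ (abs_nonneg _) (abs_real_inner_le_norm v w) 2

theorem edist_sq_eq_ofReal {E : Type*} [SeminormedAddCommGroup E] (x y : E) :
    edist x y ^ 2 = ENNReal.ofReal (‖x - y‖ ^ 2) := by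
  rw [edist_dist, dist_eq_norm, ENNReal.ofReal_pow (norm_nonneg _)]

end NoisyProj

/-! ### The moments of the noise -/

section Noise

variable {n : ℕ} {a : EuclideanSpace ℝ (Fin n)} {Ω : Type*} [MeasurableSpace Ω] {P : Measure Ω}
  {ξ : Ω → EuclideanSpace ℝ (Fin n)} {ζ : Ω → ℝ}

theorem integrable_inner_sq_div_norm_sq [IsProbabilityMeasure P]
    (hξ : Measurable ξ) (w : EuclideanSpace ℝ (Fin n)) :
    Integrable (fun ω => inner ℝ (a + ξ ω) w ^ 2 / ‖a + ξ ω‖ ^ 2) P := by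
  refine Integrable.of_bound (C := ‖w‖ ^ 2)
    (Measurable.aestronglyMeasurable (by fun_prop)) (.of_forall fun ω => ?_)
  rw [Real.norm_of_nonneg (by positivity)]
  exact inner_sq_div_norm_sq_le _ _

theorem noiseIsotropy_le_integral {z : EuclideanSpace ℝ (Fin n)} (hz : ‖z‖ = 1) :
    noiseIsotropy P a ξ ≤ ∫ ω, inner ℝ (a + ξ ω) z ^ 2 / ‖a + ξ ω‖ ^ 2 ∂P := by
  refine ciInf_le (f := fun z : Metric.sphere (0 : EuclideanSpace ℝ (Fin n)) 1 =>
    ∫ ω, inner ℝ (a + ξ ω) (z : EuclideanSpace ℝ (Fin n)) ^ 2 / ‖a + ξ ω‖ ^ 2 ∂P)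
    ⟨0, ?_⟩ ⟨z, by simpa using hz⟩
  rintro _ ⟨z, rfl⟩
  exact integral_nonneg fun ω => by positivity

theorem noiseIsotropy_mul_norm_sq_le (w : EuclideanSpace ℝ (Fin n)) :
    noiseIsotropy P a ξ * ‖w‖ ^ 2 ≤ ∫ ω, inner ℝ (a + ξ ω) w ^ 2 / ‖a + ξ ω‖ ^ 2 ∂P := by
  rcases eq_or_ne w 0 with rfl | hw
  · simp
  have hw' : ‖w‖ ≠ 0 := norm_ne_zero_iff.2 hw
  have h := noiseIsotropy_le_integral (P := P) (a := a) (ξ := ξ) (z := ‖w‖⁻¹ • w)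
    (by rw [norm_smul, norm_inv, norm_norm, inv_mul_cancel₀ hw'])
  calc noiseIsotropy P a ξ * ‖w‖ ^ 2
      ≤ (∫ ω, inner ℝ (a + ξ ω) (‖w‖⁻¹ • w) ^ 2 / ‖a + ξ ω‖ ^ 2 ∂P) * ‖w‖ ^ 2 := by gcongr
    _ = ∫ ω, inner ℝ (a + ξ ω) w ^ 2 / ‖a + ξ ω‖ ^ 2 ∂P := by
      rw [← integral_mul_const]
      congr 1
      ext ω
      rw [inner_smul_right]
      field_simp

theorem noiseIsotropy_le_one [IsProbabilityMeasure P]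
    (hξ : Measurable ξ) : noiseIsotropy P a ξ ≤ 1 := by
  -- In dimension `0` the sphere is empty and the real infimum takes the default value `0`.
  rcases isEmpty_or_nonempty (Metric.sphere (0 : EuclideanSpace ℝ (Fin n)) 1) with h | ⟨z, hz⟩
  · rw [noiseIsotropy, Real.iInf_of_isEmpty]
    exact zero_le_one
  · rw [mem_sphere_zero_iff_norm] at hz
    refine (noiseIsotropy_le_integral hz).trans ?_
    refine (integral_mono (integrable_inner_sq_div_norm_sq hξ z) (integrable_const 1)
      fun ω => ?_).trans (by simp)
    simpa [hz] using inner_sq_div_norm_sq_le (a + ξ ω) z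

theorem lintegral_edist_noisyProj_sq_le [IsProbabilityMeasure P]
    (xbar : EuclideanSpace ℝ (Fin n))
    (hξ : Measurable ξ) (hζ : Measurable ζ) (x y : EuclideanSpace ℝ (Fin n)) :
    ∫⁻ e, edist (noisyProj a xbar e x) (noisyProj a xbar e y) ^ 2 ∂(P.map fun ω => (ξ ω, ζ ω))
      ≤ ENNReal.ofReal (√(1 - noiseIsotropy P a ξ)) ^ 2 * edist x y ^ 2 := by
  have hm : ∀ x, Measurable fun e => noisyProj a xbar e x := fun x =>
    (measurable_noisyProj a xbar).comp measurable_prodMk_left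
  have hint := integrable_inner_sq_div_norm_sq (P := P) (a := a) hξ (x - y)
  have hc := sub_nonneg.2 (noiseIsotropy_le_one (P := P) (a := a) hξ)
  rw [lintegral_map (((hm x).edist (hm y)).pow_const 2) (hξ.prodMk hζ)]
  simp_rw [edist_sq_eq_ofReal, norm_noisyProj_sub_sq]
  rw [← ofReal_integral_eq_lintegral_ofReal
      (f := fun ω => ‖x - y‖ ^ 2 - inner ℝ (a + ξ ω) (x - y) ^ 2 / ‖a + ξ ω‖ ^ 2)
      ((integrable_const _).sub hint)
      (.of_forall fun ω => sub_nonneg.2 (inner_sq_div_norm_sq_le _ _)),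
    integral_sub (integrable_const _) hint, ← ENNReal.ofReal_pow (Real.sqrt_nonneg _),
    Real.sq_sqrt hc, ← ENNReal.ofReal_mul hc]
  refine ENNReal.ofReal_le_ofReal ?_
  have := noiseIsotropy_mul_norm_sq_le (P := P) (a := a) (ξ := ξ) (x - y)
  simp only [integral_const, probReal_univ, one_smul]
  linarith

/-- Independence factors `d` as `𝔼[(b + ζ)²] * 𝔼[‖a + ξ‖⁻²]`. Unless `ζ = -b` almost surely, the
first factor is nonzero, so finiteness of `d` forces the second to be finite. -/
theorem lintegral_noise_sq_div_norm_sq_lt_top [IsProbabilityMeasure P]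
    {b : ℝ} (hξ : Measurable ξ) (hζ : Measurable ζ)
    (hindep : IndepFun ξ ζ P) (hd : noiseMoment P a b ξ ζ < ∞)
    (hdeg : (∀ᵐ ω ∂P, ζ ω = -b) → ∫⁻ ω, ENNReal.ofReal (b ^ 2 / ‖a + ξ ω‖ ^ 2) ∂P < ∞) :
    ∫⁻ ω, ENNReal.ofReal (ζ ω ^ 2 / ‖a + ξ ω‖ ^ 2) ∂P < ∞ := by
  by_cases h : ∀ᵐ ω ∂P, ζ ω = -b
  · refine (lintegral_congr_ae ?_).trans_lt (hdeg h)
    filter_upwards [h] with ω hω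
    rw [hω, neg_sq]
  set f : ℝ → ℝ≥0∞ := fun t => ENNReal.ofReal ((b + t) ^ 2) with hf
  set g : EuclideanSpace ℝ (Fin n) → ℝ≥0∞ := fun v => ENNReal.ofReal (1 / ‖a + v‖ ^ 2) with hg
  have hfm : Measurable f := by fun_prop
  have hgm : Measurable g := by fun_prop
  have hfg : ∀ ω, ENNReal.ofReal ((b + ζ ω) ^ 2 / ‖a + ξ ω‖ ^ 2) = f (ζ ω) * g (ξ ω) := fun ω => by
    rw [hf, hg, ← ENNReal.ofReal_mul (sq_nonneg _), mul_one_div]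
  have hprod : noiseMoment P a b ξ ζ = (∫⁻ ω, f (ζ ω) ∂P) * ∫⁻ ω, g (ξ ω) ∂P := by
    rw [noiseMoment]
    simp_rw [hfg]
    exact lintegral_mul_eq_lintegral_mul_lintegral_of_indepFun'' (hfm.comp hζ).aemeasurable
      (hgm.comp hξ).aemeasurable (hindep.symm.comp hfm hgm)
  have hf0 : ∫⁻ ω, f (ζ ω) ∂P ≠ 0 := by
    intro h0
    replace h0 := (lintegral_eq_zero_iff (hfm.comp hζ)).1 h0
    refine h ?_
    filter_upwards [h0] with ω hω
    have h1 : (b + ζ ω) ^ 2 ≤ 0 := ENNReal.ofReal_eq_zero.1 hω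
    have h2 : b + ζ ω = 0 := by nlinarith
    linarith
  have hg1 : ∫⁻ ω, g (ξ ω) ∂P < ∞ := by
    refine lt_top_iff_ne_top.2 fun h1 => ?_
    rw [hprod, h1, ENNReal.mul_top hf0] at hd
    exact lt_irrefl _ hd
  calc ∫⁻ ω, ENNReal.ofReal (ζ ω ^ 2 / ‖a + ξ ω‖ ^ 2) ∂P
      ≤ ∫⁻ ω, (ENNReal.ofReal 2 * ENNReal.ofReal ((b + ζ ω) ^ 2 / ‖a + ξ ω‖ ^ 2)
          + ENNReal.ofReal (2 * b ^ 2) * g (ξ ω)) ∂P := by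
        refine lintegral_mono fun ω => ?_
        rw [hg, ← ENNReal.ofReal_mul (by norm_num), ← ENNReal.ofReal_mul (by positivity),
          ← ENNReal.ofReal_add (by positivity) (by positivity)]
        refine ENNReal.ofReal_le_ofReal ?_
        rw [← mul_div_assoc, mul_one_div, ← add_div]
        gcongr
        -- The identity is `2 (b + ζ)² + 2 b² - ζ² = (2 b + ζ)²`.
        nlinarith [sq_nonneg (2 * b + ζ ω)]
    _ = ENNReal.ofReal 2 * noiseMoment P a b ξ ζ + ENNReal.ofReal (2 * b ^ 2) * ∫⁻ ω, g (ξ ω) ∂P := by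
        rw [lintegral_add_left (by fun_prop),
          lintegral_const_mul' _ _ ENNReal.ofReal_ne_top,
          lintegral_const_mul' _ _ ENNReal.ofReal_ne_top, noiseMoment]
    _ < ∞ := ENNReal.add_lt_top.2 ⟨ENNReal.mul_lt_top ENNReal.ofReal_lt_top hd,
        ENNReal.mul_lt_top ENNReal.ofReal_lt_top hg1⟩

theorem lintegral_edist_noisyProj_self_sq (xbar : EuclideanSpace ℝ (Fin n))
    (hξ : Measurable ξ) (hζ : Measurable ζ) :
    ∫⁻ e, edist xbar (noisyProj a xbar e xbar) ^ 2 ∂(P.map fun ω => (ξ ω, ζ ω))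
      = ∫⁻ ω, ENNReal.ofReal (ζ ω ^ 2 / ‖a + ξ ω‖ ^ 2) ∂P := by
  have hm : Measurable fun e => noisyProj a xbar e xbar :=
    (measurable_noisyProj a xbar).comp measurable_prodMk_left
  rw [lintegral_map ((measurable_const.edist hm).pow_const 2) (hξ.prodMk hζ)]
  simp_rw [edist_sq_eq_ofReal, norm_sub_noisyProj_self_sq]

end Noise

/-! ### Assembly: the noisy projection as a mean-square contraction. -/

theorem proposition4p3 {n : ℕ} (a : EuclideanSpace ℝ (Fin n)) (b : ℝ)
    (xbar : EuclideanSpace ℝ (Fin n)) (hxbar : inner ℝ a xbar = b)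
    {Ω : Type u} [MeasurableSpace Ω] (P : Measure Ω) [IsProbabilityMeasure P]
    (ξ : Ω → EuclideanSpace ℝ (Fin n)) (ζ : Ω → ℝ) (hξ : Measurable ξ) (hζ : Measurable ζ)
    (hindep : IndepFun ξ ζ P)
    -- the perturbed hyperplanes are almost surely hyperplanes
    (hne : ∀ᵐ ω ∂P, a + ξ ω ≠ 0)
    (hd : noiseMoment P a b ξ ζ < ∞)
    -- in the degenerate case `ζ = -b` almost surely, where `d = 0` carries no information
    (hdeg : (∀ᵐ ω ∂P, ζ ω = -b) → ∫⁻ ω, ENNReal.ofReal (b ^ 2 / ‖a + ξ ω‖ ^ 2) ∂P < ∞)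
    (hc : 0 < noiseIsotropy P a ξ) :
    noiseIsotropy P a ξ ≤ 1 ∧
    ∃ π : Measure (EuclideanSpace ℝ (Fin n)),
      IsProbabilityMeasure π ∧ (noisyProjKernel P a xbar ξ ζ).Invariant π ∧
      (∀ π' : Measure (EuclideanSpace ℝ (Fin n)), IsProbabilityMeasure π' →
        (noisyProjKernel P a xbar ξ ζ).Invariant π' → π' = π) ∧
      MemP2 π ∧
      ∀ (Ω' : Type v) [MeasurableSpace Ω'] (Q : Measure Ω') [IsProbabilityMeasure Q]
        (η : ℕ → Ω' → EuclideanSpace ℝ (Fin n) × ℝ) (X : ℕ → Ω' → EuclideanSpace ℝ (Fin n)),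
        IsRFI (noisyProj a xbar) (P.map fun ω => (ξ ω, ζ ω)) Q η X →
          QLinearW2 (fun k => Q.map (X k)) π (Real.sqrt (1 - noiseIsotropy P a ξ)) ∧
          (MemP2 (Q.map (X 0)) →
            W2 (Q.map (X 0)) π < ∞ ∧
              Tendsto (fun k => W2 (Q.map (X k)) π) atTop (𝓝 0)) ∧
          (∀ f : BoundedContinuousFunction (EuclideanSpace ℝ (Fin n)) ℝ,
            Tendsto (fun k => ∫ ω, f (X k ω) ∂Q) atTop (𝓝 (∫ x, f x ∂π))) := by
  set c := noiseIsotropy P a ξ with hcdef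
  set ρ := P.map fun ω => (ξ ω, ζ ω) with hρ
  have hρprob : IsProbabilityMeasure ρ :=
    Measure.isProbabilityMeasure_map (hξ.prodMk hζ).aemeasurable
  have hc1 : c ≤ 1 := noiseIsotropy_le_one hξ
  have hT := measurable_noisyProj a xbar
  have hs1 : √(1 - c) < 1 := by
    rw [Real.sqrt_lt' one_pos]
    linarith
  set r := ENNReal.ofReal √(1 - c) with hrdef
  have hr : r < 1 := by rwa [hrdef, ENNReal.ofReal_lt_one]
  have hcontr : ∀ x y, ∫⁻ e, edist (noisyProj a xbar e x) (noisyProj a xbar e y) ^ 2 ∂ρ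
      ≤ r ^ 2 * edist x y ^ 2 := lintegral_edist_noisyProj_sq_le xbar hξ hζ
  have hcontr1 := lintegral_edist_le_of_sq hT hcontr
  have hm : ∫⁻ e, edist xbar (noisyProj a xbar e xbar) ^ 2 ∂ρ ≠ ∞ := by
    rw [hρ, lintegral_edist_noisyProj_self_sq xbar hξ hζ]
    exact (lintegral_noise_sq_div_norm_sq_lt_top hξ hζ hindep hd hdeg).ne
  obtain ⟨π, hπ, hπ2⟩ := exists_rfiStep_eq_self hT (continuous_noisyProj a xbar) hr hcontr hm
  have := hπ2.1
  refine ⟨hc1, π, this, (bind_rfiKernel hT π).trans hπ, fun π' hπ'p hπ' => ?_, hπ2, ?_⟩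
  · exact eq_of_rfiStep_eq_self hT hr hcontr1 π' π ((bind_rfiKernel hT π').symm.trans hπ') hπ
  intro Ω' _ Q _ η X hX
  have h0 := Measure.isProbabilityMeasure_map (μ := Q) hX.measurable_init.aemeasurable
  have hlaw := hX.map_eq hT
  have hstep : ∀ k, W2 (Q.map (X (k + 1))) π ≤ r * W2 (Q.map (X k)) π := fun k => by
    have := isProbabilityMeasure_iterate_rfiStep (ρ := ρ) hT (Q.map (X 0)) k
    have h := W2_rfiStep_le hT hr.ne_top hcontr ((rfiStep (noisyProj a xbar) ρ)^[k] (Q.map (X 0))) π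
    rwa [hπ, ← Function.iterate_succ_apply' (rfiStep (noisyProj a xbar) ρ), ← hlaw, ← hlaw] at h
  refine ⟨⟨Real.sqrt_nonneg _, hs1, hstep⟩, fun hP2 => ?_, fun f => ?_⟩
  · have hfin := W2_lt_top hP2 hπ2
    refine ⟨hfin, ?_⟩
    have hpow : ∀ k, W2 (Q.map (X k)) π ≤ r ^ k * W2 (Q.map (X 0)) π := fun k => by
      induction k with
      | zero => simp
      | succ k ih =>
        refine (hstep k).trans ?_
        rw [pow_succ', mul_assoc]
        exact mul_le_mul_right ih r
    have hlim : Tendsto (fun k => r ^ k * W2 (Q.map (X 0)) π) atTop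
        (𝓝 (0 * W2 (Q.map (X 0)) π)) :=
      ENNReal.Tendsto.mul_const (ENNReal.tendsto_pow_atTop_nhds_zero_of_lt_one hr)
        (.inr hfin.ne)
    rw [zero_mul] at hlim
    exact tendsto_of_tendsto_of_tendsto_of_le_of_le tendsto_const_nhds hlim
      (fun _ => zero_le) hpow
  · refine (tendsto_integral_iterate_rfiStep hT hr hcontr1 (Q.map (X 0)) π hπ f).congr fun k => ?_
    -- The recursion holds only almost surely, so measurability of `X k` is not given. Its image
    -- measure is nonzero, which forces almost-everywhere measurability, because `Measure.map` is
    -- `0` otherwise.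
    have hne0 : IsProbabilityMeasure (Q.map (X k)) := by
      rw [hlaw]
      exact isProbabilityMeasure_iterate_rfiStep hT _ k
    rw [← hlaw, integral_map (AEMeasurable.of_map_ne_zero (IsProbabilityMeasure.ne_zero _))
      f.continuous.measurable.aestronglyMeasurable]
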